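/- Let $\Gamma=(V,E,s,r)$ be a directed graph ($V$ and $E$ arbitrary sets, loops and multiple edges allowed). A path in $\Gamma$ is either a vertex $v$ (a trivial path from $v$ to $v$) or a finite sequence of edges $e_1\cdots e_n$, $n\ge 1$, with $r(e_i)=s(e_{i+1})$ for $1\le i<n$ (a path from $s(e_1)$ to $r(e_n)$). The graph $\Gamma$ is *unilaterally connected* if for all $v_1,v_2\in V$ there is a path from $v_1$ to $v_2$ or a path from $v_2$ to $v_1$, and *strongly connected* if for all $v_1,v_2\in V$ there are both a path from $v_1$ to $v_2$ and a path from $v_2$ to $v_1$. A vertex $v$ is *forked* if there are distinct edges $e,f\in s^{-1}(v)$ such that there is no path from $r(g)$ to $r(e)$ for any $g\in s^{-1}(v)\setminus\{e\}$, and no path from $r(g)$ to $r(f)$ for any $g\in s^{-1}(v)\setminus\{f\}$. Let $\mathrm{Inv}(\Gamma)$ be the graph inverse semigroup of $\Gamma$, that is, the semigroup with zero generated by $V$, $E$ and $E^*=\{e^*: e\in E\}$ subject to the relations $uv=\delta_{u,v}u$, $s(e)e=e\,r(e)=e$, $r(e)e^*=e^*s(e)=e^*$ and $f^*e=\delta_{f,e}\,r(e)$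 for all $u,v\in V$ and $e,f\in E$, where $\delta$ is the Kronecker delta. Let $\mathscr{C}(\mathrm{Inv}(\Gamma))$ be the lattice of all semigroup congruences on $\mathrm{Inv}(\Gamma)$, ordered by inclusion. If $\Gamma$ is unilaterally connected (in particular, if $\Gamma$ is strongly connected), then $\Gamma$ has no forked vertices and the lattice $\mathscr{C}(\mathrm{Inv}(\Gamma))$ is distributive, i.e. $(a\vee b)\wedge c=(a\wedge c)\vee(b\wedge c)$ for all $a,b,c\in\mathscr{C}(\mathrm{Inv}(\Gamma))$. -/

import Mathlib

/-- A directed graph is unilaterally connected if, for any two vertices, there is a (possibly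
trivial) path from the first to the second or from the second to the first. -/
def Quiver.IsUnilaterallyConnected (V : Type*) [Quiver V] : Prop :=
  ∀ v w : V, Nonempty (Quiver.Path v w) ∨ Nonempty (Quiver.Path w v)

/-- `v` is a forked vertex if there are distinct edges `e`, `f` with source `v` such that no edge
with source `v` other than `e` has a range from which the range of `e` can be reached, and
likewise for `f`. Here `Quiver.Star v` is the type of edges with source `v`, and `g.1` is the
range of such an edge `g`. -/
def Quiver.IsForked {V : Type*} [Quiver V] (v : V) : Prop :=
  ∃ e f : Quiver.Star v, e ≠ f ∧
    (∀ g : Quiver.Star v, g ≠ e → ¬ Nonempty (Quiver.Path g.1 e.1)) ∧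
    (∀ g : Quiver.Star v, g ≠ f → ¬ Nonempty (Quiver.Path g.1 f.1))

namespace GraphInverse

universe u w

/-- The generators (other than zero) of the graph inverse semigroup: the vertices, the edges `e`
and the formal inverses `e*` of the edges. The source of `e : Quiver.Total V` is `e.left` and its
range is `e.right`. -/
inductive Generator (V : Type u) [Quiver.{w} V] : Type (max u w)
  | vertex (v : V) : Generator V
  | edge (e : Quiver.Total V) : Generator V
  | edgeStar (e : Quiver.Total V) : Generator V

/-- The free semigroup with zero on the generators. -/
abbrev FreeWithZero (V : Type u) [Quiver.{w} V] : Type (max u w) :=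
  WithZero (FreeSemigroup (Generator V))

section Letters

variable {V : Type u} [Quiver.{w} V]

/-- A vertex as an element of the free semigroup with zero. -/
def vtx (v : V) : FreeWithZero V := ((FreeSemigroup.of (Generator.vertex v) :
  FreeSemigroup (Generator V)) : FreeWithZero V)

/-- An edge as an element of the free semigroup with zero. -/
def edg (e : Quiver.Total V) : FreeWithZero V := ((FreeSemigroup.of (Generator.edge e) :
  FreeSemigroup (Generator V)) : FreeWithZero V)

/-- The formal inverse of an edge as an element of the free semigroup with zero. -/
def edgStar (e : Quiver.Total V) : FreeWithZero V := ((FreeSemigroup.of (Generator.edgeStar e) :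
  FreeSemigroup (Generator V)) : FreeWithZero V)

/-- The defining relations of the graph inverse semigroup. -/
inductive Rel : FreeWithZero V → FreeWithZero V → Prop
  | vertex_mul_self (v : V) : Rel (vtx v * vtx v) (vtx v)
  | vertex_mul_of_ne (v v' : V) : v ≠ v' → Rel (vtx v * vtx v') 0
  | source_mul_edge (e : Quiver.Total V) : Rel (vtx e.left * edg e) (edg e)
  | edge_mul_range (e : Quiver.Total V) : Rel (edg e * vtx e.right) (edg e)
  | range_mul_edgeStar (e : Quiver.Total V) : Rel (vtx e.right * edgStar e) (edgStar e)
  | edgeStar_mul_source (e : Quiver.Total V) : Rel (edgStar e * vtx e.left) (edgStar e)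
  | edgeStar_mul_self (e : Quiver.Total V) : Rel (edgStar e * edg e) (vtx e.right)
  | edgeStar_mul_of_ne (f e : Quiver.Total V) : f ≠ e → Rel (edgStar f * edg e) 0

end Letters

end GraphInverse

/-- The graph inverse semigroup of a directed graph: the semigroup with zero generated by the
vertices, the edges and the formal inverses of the edges, subject to the defining relations. -/
abbrev GraphInverseSemigroup (V : Type*) [Quiver V] : Type _ :=
  (conGen (GraphInverse.Rel (V := V))).Quotient

/-- A lattice is distributive if `(a ∨ b) ∧ c = (a ∧ c) ∨ (b ∧ c)` for all `a`, `b`, `c`. -/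
def IsDistributiveLattice (L : Type*) [Lattice L] : Prop :=
  ∀ a b c : L, (a ⊔ b) ⊓ c = (a ⊓ c) ⊔ (b ⊓ c)

namespace GraphInverse

open Quiver

universe u w

variable {V : Type u} [Quiver.{w} V]

/-! Every element is 0 or a normal form `p q*`, and a congruence is determined by what it relates to
each vertex `v` inside the local monoid at `v` (`rel_of_local`). If `v ~ s t*`, then `v ~ s s*` and
`v ~ t t*`, so unless `v` is killed (related to 0), one of `s`, `t` extends the other by a closed
path. Distributivity reduces to `c ≤ a ⊔ b → c ≤ a ⊓ c ⊔ b ⊓ c`, which therefore needs checking only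
for relations `v ~ 0`, `v ~ e e*` with `e` an edge, and `v ~ u` with `u` a closed path.

A vertex killed by `a ⊔ b` leads to one killed by `a` or `b` along edges `e` with `v ~ e e*` in `a`
or `b` (`vanishes_of_sup_rel_zero`); if `c` kills `v`, it contains all these relations. For edges
(`rel_edge`), a relation of `c` already lies in `a` or `b` unless `c` kills `v`; connectivity rules
out the bad case of two competing edges. For closed paths (`rel_closed`), when `v` is not killed by
`a ⊔ b`, the differences of lengths in the related `s t*` form subgroups of `ℤ`, and the subgroup
lattice of `ℤ` is distributive. -/

/-- The semigroup-with-zero structure of the graph inverse semigroup. -/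
@[reducible]
def semigroupWithZero (V : Type u) [Quiver.{w} V] : SemigroupWithZero (GraphInverseSemigroup V) where
  zero := ((0 : FreeWithZero V) : GraphInverseSemigroup V)
  zero_mul x := by
    induction x using Con.induction_on with
    | H x => exact congrArg _ (zero_mul x)
  mul_zero x := by
    induction x using Con.induction_on with
    | H x => exact congrArg _ (mul_zero x)

attribute [local instance] semigroupWithZero

theorem coe_eq_of_rel {x y : FreeWithZero V} (h : Rel x y) :
    (x : GraphInverseSemigroup V) = (y : GraphInverseSemigroup V) :=
  (Con.eq _).2 (ConGen.Rel.of _ _ h)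

/-- A vertex as an element of the graph inverse semigroup. -/
def vertex (v : V) : GraphInverseSemigroup V := (vtx v : FreeWithZero V)

/-- An edge as an element of the graph inverse semigroup. -/
def edge {v v' : V} (e : v ⟶ v') : GraphInverseSemigroup V := (edg ⟨v, v', e⟩ : FreeWithZero V)

/-- The inverse of an edge in the graph inverse semigroup. -/
def edgeInv {v v' : V} (e : v ⟶ v') : GraphInverseSemigroup V :=
  (edgStar ⟨v, v', e⟩ : FreeWithZero V)

/-! ### Path calculus and the normal form `p q*`. -/

/-- A path as an element of the graph inverse semigroup. -/
def path {v : V} : ∀ {v' : V}, Path v v' → GraphInverseSemigroup V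
  | _, .nil => vertex v
  | _, .cons p e => path p * edge e

/-- The inverse of a path in the graph inverse semigroup. -/
def pathInv {v : V} : ∀ {v' : V}, Path v v' → GraphInverseSemigroup V
  | _, .nil => vertex v
  | _, .cons p e => edgeInv e * pathInv p

@[simp] theorem path_nil (v : V) : path (.nil : Path v v) = vertex v := rfl

@[simp] theorem pathInv_nil (v : V) : pathInv (.nil : Path v v) = vertex v := rfl

theorem path_cons {v v' v'' : V} (p : Path v v') (e : v' ⟶ v'') :
    path (p.cons e) = path p * edge e := rfl

theorem pathInv_cons {v v' v'' : V} (p : Path v v') (e : v' ⟶ v'') :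
    pathInv (p.cons e) = edgeInv e * pathInv p := rfl

@[simp] theorem vertex_mul_self (v : V) : vertex v * vertex v = vertex v :=
  coe_eq_of_rel (.vertex_mul_self v)

@[simp] theorem vertex_mul_self_mul (v : V) (x : GraphInverseSemigroup V) :
    vertex v * (vertex v * x) = vertex v * x := by
  rw [← mul_assoc, vertex_mul_self]

theorem vertex_mul_of_ne {v v' : V} (h : v ≠ v') : vertex v * vertex v' = 0 :=
  coe_eq_of_rel (.vertex_mul_of_ne v v' h)

theorem vertex_mul_edge {v v' : V} (e : v ⟶ v') : vertex v * edge e = edge e :=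
  coe_eq_of_rel (.source_mul_edge ⟨v, v', e⟩)

theorem edge_mul_vertex {v v' : V} (e : v ⟶ v') : edge e * vertex v' = edge e :=
  coe_eq_of_rel (.edge_mul_range ⟨v, v', e⟩)

theorem vertex_mul_edgeInv {v v' : V} (e : v ⟶ v') : vertex v' * edgeInv e = edgeInv e :=
  coe_eq_of_rel (.range_mul_edgeStar ⟨v, v', e⟩)

theorem edgeInv_mul_vertex {v v' : V} (e : v ⟶ v') : edgeInv e * vertex v = edgeInv e :=
  coe_eq_of_rel (.edgeStar_mul_source ⟨v, v', e⟩)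

theorem edgeInv_mul_edge {v v' : V} (e : v ⟶ v') : edgeInv e * edge e = vertex v' :=
  coe_eq_of_rel (.edgeStar_mul_self ⟨v, v', e⟩)

theorem edgeInv_mul_edge_of_ne (e f : Total V) (h : e ≠ f) :
    edgeInv e.hom * edge f.hom = 0 :=
  coe_eq_of_rel (.edgeStar_mul_of_ne e f h)

@[simp] theorem vertex_mul_path {v v' : V} (p : Path v v') : vertex v * path p = path p := by
  induction p with
  | nil => simp
  | cons p e ih => rw [path_cons, ← mul_assoc, ih]

@[simp] theorem path_mul_vertex {v v' : V} (p : Path v v') : path p * vertex v' = path p := by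
  cases p with
  | nil => simp
  | cons p e => rw [path_cons, mul_assoc, edge_mul_vertex]

@[simp] theorem vertex_mul_pathInv {v v' : V} (p : Path v v') :
    vertex v' * pathInv p = pathInv p := by
  cases p with
  | nil => simp
  | cons p e => rw [pathInv_cons, ← mul_assoc, vertex_mul_edgeInv]

@[simp] theorem pathInv_mul_vertex {v v' : V} (p : Path v v') :
    pathInv p * vertex v = pathInv p := by
  induction p with
  | nil => simp
  | cons p e ih => rw [pathInv_cons, mul_assoc, ih]

@[simp] theorem vertex_mul_path_mul {v v' : V} (p : Path v v') (x : GraphInverseSemigroup V) :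
    vertex v * (path p * x) = path p * x := by
  rw [← mul_assoc, vertex_mul_path]

@[simp] theorem path_mul_vertex_mul {v v' : V} (p : Path v v') (x : GraphInverseSemigroup V) :
    path p * (vertex v' * x) = path p * x := by
  rw [← mul_assoc, path_mul_vertex]

@[simp] theorem vertex_mul_pathInv_mul {v v' : V} (p : Path v v')
    (x : GraphInverseSemigroup V) : vertex v' * (pathInv p * x) = pathInv p * x := by
  rw [← mul_assoc, vertex_mul_pathInv]

@[simp] theorem pathInv_mul_vertex_mul {v v' : V} (p : Path v v')
    (x : GraphInverseSemigroup V) : pathInv p * (vertex v * x) = pathInv p * x := by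
  rw [← mul_assoc, pathInv_mul_vertex]

@[simp] theorem pathInv_mul_path {v v' : V} (p : Path v v') :
    pathInv p * path p = vertex v' := by
  induction p with
  | nil => simp
  | cons p e ih =>
    rw [pathInv_cons, path_cons, mul_assoc, ← mul_assoc (pathInv p), ih, vertex_mul_edge,
      edgeInv_mul_edge]

@[simp] theorem pathInv_mul_path_mul {v v' : V} (p : Path v v') (x : GraphInverseSemigroup V) :
    pathInv p * (path p * x) = vertex v' * x := by
  rw [← mul_assoc, pathInv_mul_path]

@[simp] theorem path_comp {v v' v'' : V} (p : Path v v') (q : Path v' v'') :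
    path (p.comp q) = path p * path q := by
  induction q with
  | nil => simp
  | cons q e ih => rw [Path.comp_cons, path_cons, path_cons, ih, mul_assoc]

@[simp] theorem pathInv_comp {v v' v'' : V} (p : Path v v') (q : Path v' v'') :
    pathInv (p.comp q) = pathInv q * pathInv p := by
  induction q with
  | nil => simp
  | cons q e ih => rw [Path.comp_cons, pathInv_cons, pathInv_cons, ih, mul_assoc]

theorem path_toPath {v v' : V} (e : v ⟶ v') : path e.toPath = edge e := by
  simp [Hom.toPath, path_cons, vertex_mul_edge]

theorem pathInv_toPath {v v' : V} (e : v ⟶ v') : pathInv e.toPath = edgeInv e := by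
  simp [Hom.toPath, pathInv_cons, edgeInv_mul_vertex]

theorem pathInv_mul_path_of_ne {v₁ v₂ w₁ w₂ : V} (p : Path v₁ w₁) (q : Path v₂ w₂)
    (h : v₁ ≠ v₂) : pathInv p * path q = 0 := by
  rw [← pathInv_mul_vertex p, ← vertex_mul_path q, mul_assoc, ← mul_assoc (vertex v₁),
    vertex_mul_of_ne h, zero_mul, mul_zero]

theorem exists_eq_toPath_comp {v v' : V} (p : Path v v') (h : p.length ≠ 0) :
    ∃ (w : V) (e : v ⟶ w) (q : Path w v'), p = e.toPath.comp q := by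
  obtain ⟨w, e, q, hq, -⟩ := (Path.length_ne_zero_iff_eq_comp p).1 h
  exact ⟨w, e, q, hq⟩

/-- If neither path extends the other, they part at two distinct edges, whose product `f* e` is 0.
-/
theorem prefix_or_prefix_or_pathInv_mul_path_eq_zero {v w₁ w₂ : V} (p : Path v w₁)
    (q : Path v w₂) :
    (∃ r : Path w₁ w₂, q = p.comp r) ∨ (∃ r : Path w₂ w₁, p = q.comp r) ∨
      pathInv p * path q = 0 := by
  induction p with
  | nil => exact .inl ⟨q, by simp⟩
  | @cons w w' p e ih =>
    rcases ih with ⟨r, rfl⟩ | ⟨r, rfl⟩ | h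
    · by_cases hr : r.length = 0
      · obtain rfl := Path.eq_of_length_zero r hr
        obtain rfl := Path.eq_nil_of_length_zero r hr
        exact .inr (.inl ⟨e.toPath, rfl⟩)
      · obtain ⟨x, f, r, rfl⟩ := exists_eq_toPath_comp r hr
        by_cases hef : (⟨w, w', e⟩ : Total V) = ⟨w, x, f⟩
        · obtain ⟨-, rfl, hh⟩ := Total.mk.inj hef
          obtain rfl := eq_of_heq hh
          exact .inl ⟨r, by rw [← Path.comp_toPath_eq_cons, Path.comp_assoc]⟩
        · refine .inr (.inr ?_)
          have h0 := edgeInv_mul_edge_of_ne _ _ hef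
          dsimp only at h0
          have h1 : edgeInv e * (vertex w * (edge f * path r)) = 0 := by
            rw [← mul_assoc (vertex w), vertex_mul_edge, ← mul_assoc, h0, zero_mul]
          simpa [pathInv_cons, mul_assoc, path_toPath, vertex_mul_edge] using h1
    · exact .inr (.inl ⟨r.cons e, by simp⟩)
    · exact .inr (.inr (by rw [pathInv_cons, mul_assoc, h, mul_zero]))

/-- Every element of the graph inverse semigroup is zero or of the form `p q*`. -/
theorem eq_zero_or_exists_path_mul_pathInv (x : GraphInverseSemigroup V) :
    x = 0 ∨ ∃ (v₁ v₂ v₃ : V) (p : Path v₁ v₃) (q : Path v₂ v₃), x = path p * pathInv q := by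
  have key : ∀ (g : Generator V) (x : GraphInverseSemigroup V),
      (x = 0 ∨ ∃ (v₁ v₂ v₃ : V) (p : Path v₁ v₃) (q : Path v₂ v₃), x = path p * pathInv q) →
      (((FreeSemigroup.of g : FreeSemigroup (Generator V)) : FreeWithZero V) :
          GraphInverseSemigroup V) * x = 0 ∨
        ∃ (v₁ v₂ v₃ : V) (p : Path v₁ v₃) (q : Path v₂ v₃),
          (((FreeSemigroup.of g : FreeSemigroup (Generator V)) : FreeWithZero V) :
          GraphInverseSemigroup V) * x = path p * pathInv q := by
    rintro g x (rfl | ⟨v₁, v₂, v₃, p, q, rfl⟩)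
    · exact .inl (mul_zero _)
    · cases g with
      | vertex v =>
        change vertex v * _ = 0 ∨ ∃ (v₁ v₂ v₃ : V) (p : Path v₁ v₃) (q : Path v₂ v₃),
          vertex v * _ = _
        by_cases h : v = v₁
        · subst h
          exact .inr ⟨_, _, _, p, q, by simp⟩
        · refine .inl ?_
          rw [← vertex_mul_path p, ← mul_assoc, ← mul_assoc, vertex_mul_of_ne h, zero_mul,
            zero_mul]
      | edge e =>
        obtain ⟨v, v', e⟩ := e
        change edge e * _ = 0 ∨ ∃ (v₁ v₂ v₃ : V) (p : Path v₁ v₃) (q : Path v₂ v₃),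
          edge e * _ = _
        by_cases h : v' = v₁
        · subst h
          exact .inr ⟨_, _, _, e.toPath.comp p, q, by simp [path_toPath, mul_assoc]⟩
        · refine .inl ?_
          rw [← vertex_mul_path p, ← edge_mul_vertex e, mul_assoc, mul_assoc,
            ← mul_assoc (vertex v'), vertex_mul_of_ne h, zero_mul, mul_zero]
      | edgeStar e =>
        obtain ⟨v, v', e⟩ := e
        change edgeInv e * _ = 0 ∨ ∃ (v₁ v₂ v₃ : V) (p : Path v₁ v₃) (q : Path v₂ v₃),
          edgeInv e * _ = _
        by_cases h : v = v₁
        · subst h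
          rw [← pathInv_toPath, ← mul_assoc]
          rcases prefix_or_prefix_or_pathInv_mul_path_eq_zero e.toPath p with
            ⟨r, rfl⟩ | ⟨r, hr⟩ | h
          · exact .inr ⟨_, _, _, r, q, by simp⟩
          · refine .inr ⟨_, _, _, .nil, q.comp r, ?_⟩
            rw [hr]
            simp [mul_assoc]
          · exact .inl (by rw [h, zero_mul])
        · refine .inl ?_
          rw [← vertex_mul_path p, ← edgeInv_mul_vertex e, mul_assoc, mul_assoc,
            ← mul_assoc (vertex v), vertex_mul_of_ne h, zero_mul, mul_zero]
  induction x using Con.induction_on with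
  | H x =>
    induction x using WithZero.recZeroCoe with
    | zero => exact .inl rfl
    | coe x =>
      induction x using FreeSemigroup.recOnMul with
      | ih1 g =>
        cases g with
        | vertex v => exact .inr ⟨v, v, v, .nil, .nil, by simp; rfl⟩
        | edge e =>
          exact .inr ⟨_, _, _, e.hom.toPath, .nil, by simp [path_toPath, edge_mul_vertex]; rfl⟩
        | edgeStar e =>
          exact .inr ⟨_, _, _, .nil, e.hom.toPath,
            by simp [pathInv_toPath, vertex_mul_edgeInv]; rfl⟩
      | ih2 g y _ ih => exact key g _ ih

theorem eq_zero_or_exists_of_local {v : V} {x : GraphInverseSemigroup V}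
    (hx : vertex v * x * vertex v = x) :
    x = 0 ∨ ∃ (w : V) (p q : Path v w), x = path p * pathInv q := by
  rcases eq_zero_or_exists_path_mul_pathInv x with rfl | ⟨v₁, v₂, w, p, q, rfl⟩
  · exact .inl rfl
  · by_cases h₁ : v = v₁
    · by_cases h₂ : v₂ = v
      · subst h₁ h₂
        exact .inr ⟨w, p, q, rfl⟩
      · refine .inl ?_
        rw [← hx, ← pathInv_mul_vertex q, mul_assoc, mul_assoc, mul_assoc,
          vertex_mul_of_ne h₂]
        simp
    · refine .inl ?_
      rw [← hx, ← vertex_mul_path p, mul_assoc (vertex v₁), ← mul_assoc (vertex v),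
          vertex_mul_of_ne h₁]
      simp

theorem idem_path_comm {v₁ v₂ w₁ w₂ : V} (p : Path v₁ w₁) (q : Path v₂ w₂) :
    path p * pathInv p * (path q * pathInv q) = path q * pathInv q * (path p * pathInv p) := by
  by_cases h : v₁ = v₂
  · subst h
    rcases prefix_or_prefix_or_pathInv_mul_path_eq_zero p q with ⟨r, rfl⟩ | ⟨r, rfl⟩ | h
    · simp [mul_assoc]
    · simp [mul_assoc]
    · rcases prefix_or_prefix_or_pathInv_mul_path_eq_zero q p with ⟨r, rfl⟩ | ⟨r, rfl⟩ | h'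
      · simp [mul_assoc]
      · simp [mul_assoc]
      · rw [mul_assoc, ← mul_assoc (pathInv p), h, mul_assoc, ← mul_assoc (pathInv q), h']
        simp
  · have h₁ := pathInv_mul_path_of_ne p q h
    have h₂ := pathInv_mul_path_of_ne q p (Ne.symm h)
    rw [mul_assoc, ← mul_assoc (pathInv p), h₁, mul_assoc, ← mul_assoc (pathInv q), h₂]
    simp

/-- A predicate that is invariant under two congruences is invariant under their join. -/
theorem sup_invariant {M : Type*} [Mul M] {a b : Con M} {T : M → Prop}
    (ha : ∀ x y, a x y → T x → T y) (hb : ∀ x y, b x y → T x → T y) {x y : M}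
    (h : (a ⊔ b) x y) : T x → T y := by
  let c : Con M :=
    { r := Relation.EqvGen fun x y => a x y ∨ b x y
      iseqv := Relation.EqvGen.is_equivalence _
      mul' := by
        intro w x y z h₁ h₂
        have h₃ : ∀ {w x : M} (y : M), Relation.EqvGen (fun x y => a x y ∨ b x y) w x →
            Relation.EqvGen (fun x y => a x y ∨ b x y) (w * y) (x * y) := by
          intro w x y h
          induction h with
          | rel w x h =>
            exact .rel _ _ (h.imp (fun h => a.mul h (a.refl y)) fun h => b.mul h (b.refl y))
          | refl w => exact .refl _
          | symm _ _ _ ih => exact .symm _ _ ih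
          | trans _ _ _ _ _ ih₁ ih₂ => exact .trans _ _ _ ih₁ ih₂
        have h₄ : ∀ {w x : M} (y : M), Relation.EqvGen (fun x y => a x y ∨ b x y) w x →
            Relation.EqvGen (fun x y => a x y ∨ b x y) (y * w) (y * x) := by
          intro w x y h
          induction h with
          | rel w x h =>
            exact .rel _ _ (h.imp (fun h => a.mul (a.refl y) h) fun h => b.mul (b.refl y) h)
          | refl w => exact .refl _
          | symm _ _ _ ih => exact .symm _ _ ih
          | trans _ _ _ _ _ ih₁ ih₂ => exact .trans _ _ _ ih₁ ih₂
        exact .trans _ _ _ (h₃ y h₁) (h₄ x h₂) }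
  have hc : a ⊔ b ≤ c := sup_le (fun _ _ h => .rel _ _ (.inl h)) fun _ _ h => .rel _ _ (.inr h)
  have h' : Relation.EqvGen (fun x y => a x y ∨ b x y) x y := hc h
  have key : T x ↔ T y := by
    clear h
    induction h' with
    | rel x y h =>
      rcases h with h | h
      · exact ⟨ha _ _ h, ha _ _ (a.symm h)⟩
      · exact ⟨hb _ _ h, hb _ _ (b.symm h)⟩
    | refl x => exact Iff.rfl
    | symm x y h ih => exact ih.symm
    | trans x y z _ _ ih₁ ih₂ => exact ih₁.trans ih₂
  exact key.1

/-! ### Relations between a vertex and its local monoid. -/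

variable {ρ : Con (GraphInverseSemigroup V)}

theorem rel_mul_mul {x y : GraphInverseSemigroup V} (h : ρ x y) (z t : GraphInverseSemigroup V) :
    ρ (z * (x * t)) (z * (y * t)) :=
  ρ.mul (ρ.refl z) (ρ.mul h (ρ.refl t))

/-- With `x = p q*` and `x' = q p*`, the relation `v ~ x` gives `x' = v x' v ~ x x' x = x`. -/
theorem rel_inv {v w : V} {p q : Path v w} (h : ρ (vertex v) (path p * pathInv q)) :
    ρ (vertex v) (path q * pathInv p) := by
  have h₁ := ρ.mul h (ρ.mul (ρ.refl (path q * pathInv p)) h)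
  simp only [mul_assoc, pathInv_mul_path_mul, pathInv_mul_vertex, vertex_mul_path_mul,
    vertex_mul_pathInv] at h₁
  exact ρ.trans h (ρ.symm h₁)

theorem rel_left {v w : V} {p q : Path v w} (h : ρ (vertex v) (path p * pathInv q)) :
    ρ (vertex v) (path p * pathInv p) := by
  simpa [mul_assoc] using ρ.mul h (rel_inv h)

theorem rel_right {v w : V} {p q : Path v w} (h : ρ (vertex v) (path p * pathInv q)) :
    ρ (vertex v) (path q * pathInv q) :=
  rel_left (rel_inv h)

theorem rel_zero_of_path {v w : V} (p : Path v w) (h : ρ (vertex v) 0) : ρ (vertex w) 0 := by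
  simpa using rel_mul_mul h (pathInv p) (path p)

theorem rel_zero_of_rel {v w : V} {p q : Path v w} (h : ρ (vertex v) (path p * pathInv q))
    (hw : ρ (vertex w) 0) : ρ (vertex v) 0 :=
  ρ.trans h (by simpa using rel_mul_mul hw (path p) (pathInv q))

/-- The idempotent of a longer path absorbs that of its prefix. -/
theorem rel_of_rel_comp {v w x : V} {s : Path v w} {t : Path w x}
    (h : ρ (vertex v) (path (s.comp t) * pathInv (s.comp t))) :
    ρ (vertex v) (path s * pathInv s) := by
  have h₁ := ρ.mul (ρ.refl (path s * pathInv s)) h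
  simp [mul_assoc] at h₁
  refine ρ.trans h (ρ.symm ?_)
  simpa [mul_assoc] using h₁

theorem rel_comp_right {v w y : V} {s : Path v w} {t t' : Path w y}
    (h : ρ (vertex v) (path (s.comp t) * pathInv (s.comp t'))) :
    ρ (vertex w) (path t * pathInv t') := by
  simpa [mul_assoc] using rel_mul_mul h (pathInv s) (path s)

theorem rel_comp {v w x : V} {s s' : Path v w} {t t' : Path w x}
    (hs : ρ (vertex v) (path s * pathInv s')) (ht : ρ (vertex w) (path t * pathInv t')) :
    ρ (vertex v) (path (s.comp t) * pathInv (s'.comp t')) := by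
  refine ρ.trans hs ?_
  simpa [mul_assoc] using rel_mul_mul ht (path s) (pathInv s')

/-- If the paths diverged, then `v ~ p p* q q* = 0`. -/
theorem prefix_or_prefix {v w₁ w₂ : V} (hv : ¬ ρ (vertex v) 0) {p : Path v w₁} {q : Path v w₂}
    (hp : ρ (vertex v) (path p * pathInv p)) (hq : ρ (vertex v) (path q * pathInv q)) :
    (∃ r : Path w₁ w₂, q = p.comp r) ∨ ∃ r : Path w₂ w₁, p = q.comp r := by
  rcases prefix_or_prefix_or_pathInv_mul_path_eq_zero p q with h | h | h
  · exact .inl h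
  · exact .inr h
  · refine (hv ?_).elim
    have h₁ := ρ.mul hp hq
    rw [mul_assoc, ← mul_assoc (pathInv p), h] at h₁
    simpa using h₁

theorem eq_of_length_eq {v w : V} (hv : ¬ ρ (vertex v) 0) {p q : Path v w}
    (hp : ρ (vertex v) (path p * pathInv p)) (hq : ρ (vertex v) (path q * pathInv q))
    (h : p.length = q.length) : p = q := by
  rcases prefix_or_prefix hv hp hq with ⟨r, rfl⟩ | ⟨r, rfl⟩ <;>
  · rw [Path.length_comp] at h
    rw [Path.eq_nil_of_length_zero r (by omega), Path.comp_nil]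

theorem prefix_of_length_le {v w₁ w₂ : V} (hv : ¬ ρ (vertex v) 0) {p : Path v w₁}
    {q : Path v w₂} (hp : ρ (vertex v) (path p * pathInv p))
    (hq : ρ (vertex v) (path q * pathInv q)) (h : p.length ≤ q.length) :
    ∃ r : Path w₁ w₂, q = p.comp r := by
  rcases prefix_or_prefix hv hp hq with h' | ⟨r, rfl⟩
  · exact h'
  · rw [Path.length_comp] at h
    obtain rfl := Path.eq_of_length_zero r (by omega)
    exact ⟨.nil, by rw [Path.eq_nil_of_length_zero r (by omega)]; simp⟩

/-- If a vertex is related to a nontrivial closed path, it is related to arbitrarily long ones. -/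
theorem exists_long_closed_path {v : V} {u : Path v v} (hu : u.length ≠ 0)
    (h : ρ (vertex v) (path u)) (n : ℕ) :
    ∃ r : Path v v, n ≤ r.length ∧ ρ (vertex v) (path r) := by
  induction n with
  | zero => exact ⟨.nil, Nat.zero_le _, ρ.refl _⟩
  | succ n ih =>
    obtain ⟨r, hr, hr'⟩ := ih
    exact ⟨r.comp u, by rw [Path.length_comp]; omega, by simpa using ρ.mul hr' h⟩

/-- A congruence below `σ` is determined by its restrictions to the local submonoids at
vertices. -/
theorem rel_of_local {σ τ : Con (GraphInverseSemigroup V)}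
    (H : ∀ (v : V) (z : GraphInverseSemigroup V), vertex v * z * vertex v = z →
      σ (vertex v) z → τ (vertex v) z) {x y : GraphInverseSemigroup V} (h : σ x y) : τ x y := by
  have key : ∀ {v₁ v₂ w : V} {p : Path v₁ w} {q : Path v₂ w} {y : GraphInverseSemigroup V},
      σ (path p * pathInv q) y →
        τ (path p * pathInv q) (path p * pathInv p * y * (path q * pathInv q)) := by
    intro v₁ v₂ w p q y h
    -- Since `p* (p q*) q` is the vertex `w`, compressing moves the relation to the local monoid at
    -- `w`; multiplying back by `p` and `q*` undoes this.
    have h₁ := rel_mul_mul h (pathInv p) (path q)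
    have h₂ := H w (pathInv p * (y * path q)) (by simp [mul_assoc])
      (by simpa [mul_assoc] using h₁)
    simpa [mul_assoc] using rel_mul_mul h₂ (path p) (pathInv q)
  rcases eq_zero_or_exists_path_mul_pathInv x with rfl | ⟨v₁, v₂, w, p, q, rfl⟩
  · rcases eq_zero_or_exists_path_mul_pathInv y with rfl | ⟨v₁, v₂, w, p, q, rfl⟩
    · exact τ.refl _
    · simpa using τ.symm (key (σ.symm h))
  · rcases eq_zero_or_exists_path_mul_pathInv y with rfl | ⟨v₃, v₄, w', s, t, rfl⟩
    · simpa using key h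
    · have h₁ := key h
      have h₂ := key (σ.symm h)
      have h₃ := τ.mul (τ.mul (τ.refl (path s * pathInv s)) h₁) (τ.refl (path t * pathInv t))
      -- As path idempotents commute, `s s*` and `t t*` move inwards and are absorbed by `s t*`, so
      -- the two compressed relations can be chained.
      have h₄ : path s * pathInv s *
          (path p * pathInv p * (path s * pathInv t) * (path q * pathInv q)) *
            (path t * pathInv t) =
          path p * pathInv p * (path s * pathInv t) * (path q * pathInv q) := by
        calc
          _ = path s * pathInv s * (path p * pathInv p) * (path s * pathInv t) *
              (path q * pathInv q * (path t * pathInv t)) := by simp only [mul_assoc]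
          _ = _ := by
            rw [idem_path_comm s p, idem_path_comm q t]
            simp [mul_assoc]
      rw [h₄] at h₃
      exact τ.trans h₁ (τ.trans (τ.symm h₃) (τ.symm h₂))

/-! ### Vertices and edges under a join. -/

variable {a b c : Con (GraphInverseSemigroup V)}

/-- Conjugating `v ~ e e*` by an edge `f ≠ e` gives `r(f) = f* f ~ f* e e* f = 0`. -/
theorem eq_or_rel_zero {v w w' : V} {e : v ⟶ w}
    (h : ρ (vertex v) (path e.toPath * pathInv e.toPath)) (f : v ⟶ w') :
    (⟨w, e⟩ : Star v) = ⟨w', f⟩ ∨ ρ (vertex w') 0 := by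
  by_cases hef : (⟨v, w', f⟩ : Total V) = ⟨v, w, e⟩
  · obtain ⟨-, rfl, hh⟩ := Total.mk.inj hef
    obtain rfl := eq_of_heq hh
    exact .inl rfl
  · have h₀ : pathInv f.toPath * path e.toPath = 0 := by
      rw [path_toPath, pathInv_toPath]
      exact edgeInv_mul_edge_of_ne _ _ hef
    have h₁ := rel_mul_mul h (pathInv f.toPath) (path f.toPath)
    rw [mul_assoc, ← mul_assoc (pathInv f.toPath) (path e.toPath), h₀] at h₁
    exact .inr (by simpa using h₁)

/-- The vertices identified with zero in the join of two congruences, see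
`vanishes_of_sup_rel_zero`. -/
inductive Vanishes (a b : Con (GraphInverseSemigroup V)) : V → Prop
  | of_rel_zero {v : V} : a (vertex v) 0 ∨ b (vertex v) 0 → Vanishes a b v
  | of_edge {v w : V} (e : v ⟶ w) :
    a (vertex v) (path e.toPath * pathInv e.toPath) ∨
      b (vertex v) (path e.toPath * pathInv e.toPath) → Vanishes a b w → Vanishes a b v

theorem Vanishes.symm {v : V} (h : Vanishes a b v) : Vanishes b a v := by
  induction h with
  | of_rel_zero h => exact .of_rel_zero h.symm
  | of_edge e h _ ih => exact .of_edge e h.symm ih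

theorem Vanishes.of_path {v w : V} (h : Vanishes a b v) (p : Path v w) : Vanishes a b w := by
  have edge : ∀ {v w : V}, Vanishes a b v → (v ⟶ w) → Vanishes a b w := by
    intro v w h f
    cases h with
    | of_rel_zero h =>
      exact .of_rel_zero (h.imp (rel_zero_of_path f.toPath) (rel_zero_of_path f.toPath))
    | of_edge e h hw =>
      rcases h with h | h
      · rcases eq_or_rel_zero h f with h | h
        · cases h
          exact hw
        · exact .of_rel_zero (.inl h)
      · rcases eq_or_rel_zero h f with h | h
        · cases h
          exact hw
        · exact .of_rel_zero (.inr h)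
  induction p with
  | nil => exact h
  | cons p e ih => exact edge ih e

theorem Vanishes.of_rel_path {v w : V} {p : Path v w}
    (h : a (vertex v) (path p * pathInv p)) (hw : Vanishes a b w) : Vanishes a b v := by
  induction p with
  | nil => exact hw
  | cons p e ih =>
    rw [← Path.comp_toPath_eq_cons] at h
    exact ih (rel_of_rel_comp h) (.of_edge e (.inl (rel_comp_right h)) hw)

/-- A nonzero product through `h` has a normal form whose middle vertex is reachable from `h`, and
vanishing passes along paths. -/
theorem Vanishes.eq_zero_or_exists {h : V} (hh : Vanishes a b h)
    (x y : GraphInverseSemigroup V) :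
    x * (vertex h * y) = 0 ∨ ∃ (v₁ v₂ v₃ : V) (p : Path v₁ v₃) (q : Path v₂ v₃),
      x * (vertex h * y) = path p * pathInv q ∧ Vanishes a b v₃ := by
  rcases eq_zero_or_exists_path_mul_pathInv x with rfl | ⟨v₁, v₂, v₃, p, q, rfl⟩
  · simp
  rcases eq_zero_or_exists_path_mul_pathInv y with rfl | ⟨w₁, w₂, w₃, s, t, rfl⟩
  · simp
  by_cases h₁ : v₂ = h
  · subst h₁
    by_cases h₂ : v₂ = w₁
    · subst h₂
      rcases prefix_or_prefix_or_pathInv_mul_path_eq_zero q s with ⟨r, rfl⟩ | ⟨r, rfl⟩ | h₃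
      · exact .inr ⟨_, _, _, p.comp r, t, by simp [mul_assoc], hh.of_path (q.comp r)⟩
      · exact .inr ⟨_, _, _, p, t.comp r, by simp [mul_assoc], hh.of_path (s.comp r)⟩
      · left
        simp only [mul_assoc, pathInv_mul_vertex_mul]
        rw [← mul_assoc (pathInv q), h₃]
        simp
    · left
      rw [← vertex_mul_path s, mul_assoc (vertex w₁), ← mul_assoc (vertex v₂),
        vertex_mul_of_ne h₂]
      simp
  · left
    rw [← pathInv_mul_vertex q, mul_assoc, mul_assoc, ← mul_assoc (vertex v₂),
      vertex_mul_of_ne h₁]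
    simp

theorem Vanishes.of_rel {v h : V} (hh : Vanishes a b h) {x y : GraphInverseSemigroup V}
    (hv : a (vertex v) (x * (vertex h * y))) : Vanishes a b v := by
  have h₁ := rel_mul_mul hv (vertex v) (vertex v)
  simp only [vertex_mul_self] at h₁
  have h₂ : vertex v * (x * (vertex h * y) * vertex v) =
      (vertex v * x) * (vertex h * (y * vertex v)) := by simp only [mul_assoc]
  rcases hh.eq_zero_or_exists (vertex v * x) (y * vertex v) with
    h₃ | ⟨v₁, v₂, v₃, p, q, h₃, h₄⟩
  · rw [h₂, h₃] at h₁
    exact .of_rel_zero (.inl h₁)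
  · rw [h₂, h₃] at h₁
    by_cases hv₁ : v = v₁
    · by_cases hv₂ : v₂ = v
      · subst hv₁ hv₂
        exact .of_rel_path (rel_left h₁) h₄
      · refine .of_rel_zero (.inl ?_)
        have h₅ := a.mul h₁ (a.refl (vertex v))
        rw [← pathInv_mul_vertex q, mul_assoc, mul_assoc, vertex_mul_of_ne hv₂] at h₅
        simpa using h₅
    · refine .of_rel_zero (.inl ?_)
      have h₅ := a.mul (a.refl (vertex v)) h₁
      rw [← vertex_mul_path p, ← mul_assoc, ← mul_assoc, vertex_mul_of_ne hv₁] at h₅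
      simpa using h₅

theorem vanishes_of_sup_rel_zero {v : V} (hv : (a ⊔ b) (vertex v) 0) : Vanishes a b v := by
  -- `T` is membership in the ideal generated by the vanishing vertices. It contains 0 and is
  -- invariant under both congruences, hence under their join.
  let T : Con (GraphInverseSemigroup V) → Con (GraphInverseSemigroup V) →
      GraphInverseSemigroup V → Prop := fun a b z =>
    z = 0 ∨ ∃ (h : V) (x y : GraphInverseSemigroup V), Vanishes a b h ∧ z = x * (vertex h * y)
  have key : ∀ a b : Con (GraphInverseSemigroup V), ∀ x y, a x y → T a b x → T a b y := by
    intro a b x y hxy hx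
    rcases eq_zero_or_exists_path_mul_pathInv y with rfl | ⟨v₁, v₂, w, p, q, rfl⟩
    · exact .inl rfl
    · have h₁ := rel_mul_mul hxy (pathInv p) (path q)
      simp only [mul_assoc, pathInv_mul_path_mul, pathInv_mul_path, vertex_mul_self] at h₁
      refine .inr ⟨w, path p, pathInv q, ?_, by simp⟩
      rcases hx with rfl | ⟨h, x', y', hh, rfl⟩
      · exact .of_rel_zero (.inl (a.symm (by simpa using h₁)))
      · refine hh.of_rel (x := pathInv p * x') (y := y' * path q) (a.symm ?_)
        simpa only [mul_assoc] using h₁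
  have hT : T a b (vertex v) := by
    refine sup_invariant (key a b) (fun x y hxy hx => ?_) ((a ⊔ b).symm hv) (.inl rfl)
    have symm : ∀ {a b : Con (GraphInverseSemigroup V)} {z}, T a b z → T b a z :=
      fun h => h.imp_right fun ⟨h, x, y, hh, hz⟩ => ⟨h, x, y, hh.symm, hz⟩
    exact symm (key b a x y hxy (symm hx))
  rcases hT with h | ⟨h, x, y, hh, hz⟩
  · exact .of_rel_zero (.inl (h ▸ a.refl _))
  · refine hh.of_rel (x := x) (y := y) ?_
    rw [← hz]
    exact a.refl _

theorem rel_of_rel_zero {v w : V} (h : ρ (vertex v) 0) (p : Path v w)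
    (x : GraphInverseSemigroup V) : ρ (vertex v) (path p * x) :=
  ρ.trans h (by simpa using ρ.symm (ρ.mul h (ρ.refl (path p * x))))

theorem Vanishes.rel_zero {v : V} (h : Vanishes a b v) (hc : c (vertex v) 0) :
    (a ⊓ c ⊔ b ⊓ c) (vertex v) 0 := by
  have ha : a ⊓ c ≤ a ⊓ c ⊔ b ⊓ c := le_sup_left
  have hb : b ⊓ c ≤ a ⊓ c ⊔ b ⊓ c := le_sup_right
  induction h with
  | of_rel_zero h => exact h.elim (fun h => ha ⟨h, hc⟩) fun h => hb ⟨h, hc⟩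
  | @of_edge v w e h _ ih =>
    have h₁ := ih (rel_zero_of_path e.toPath hc)
    have h₂ : c (vertex v) (path e.toPath * pathInv e.toPath) :=
      rel_of_rel_zero hc _ _
    exact rel_zero_of_rel (h.elim (fun h => ha ⟨h, h₂⟩) fun h => hb ⟨h, h₂⟩) h₁

/-- The only place where distributivity uses connectivity. If `v ~ f f*` in `a` and `v ~ e e*` in
`c` with `e ≠ f`, then `a` kills `r(e)` and `c` kills `r(f)`. A path from `r(e)` to `r(f)` makes `a`
kill `v`; a path the other way makes `c` kill `v`, which is excluded. -/
theorem Vanishes.rel_edge (hV : IsUnilaterallyConnected V) {v w : V} {e : v ⟶ w}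
    (h : Vanishes a b v) (hc : c (vertex v) (path e.toPath * pathInv e.toPath))
    (hc₀ : ¬ c (vertex v) 0) :
    a (vertex v) (path e.toPath * pathInv e.toPath) ∨
      b (vertex v) (path e.toPath * pathInv e.toPath) := by
  cases h with
  | of_rel_zero h => exact h.imp (rel_of_rel_zero · _ _) (rel_of_rel_zero · _ _)
  | @of_edge _ w' f h _ =>
    have key : ∀ a : Con (GraphInverseSemigroup V),
        a (vertex v) (path f.toPath * pathInv f.toPath) →
          a (vertex v) (path e.toPath * pathInv e.toPath) := by
      intro a ha
      rcases eq_or_rel_zero ha e with h | h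
      · cases h
        exact ha
      rcases eq_or_rel_zero hc f with h' | h'
      · cases h'
        exact ha
      rcases hV w w' with ⟨⟨p⟩⟩ | ⟨⟨p⟩⟩
      · exact rel_of_rel_zero (rel_zero_of_rel ha (rel_zero_of_path p h)) _ _
      · exact (hc₀ (rel_zero_of_rel hc (rel_zero_of_path p h'))).elim
    exact h.imp (key a) (key b)

/-- If neither congruence had the relation, no nontrivial `s` could satisfy `v ~ s s*` in either:
starting with `e` is ruled out, and starting with another edge kills `r(e)`, hence `v` in the join.
So the condition `v x v = v` would be invariant under the join and force `e e* = v`. -/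
theorem rel_edge_of_sup_rel_edge {v w : V} {e : v ⟶ w} (hv : ¬ (a ⊔ b) (vertex v) 0)
    (he : (a ⊔ b) (vertex v) (path e.toPath * pathInv e.toPath)) :
    a (vertex v) (path e.toPath * pathInv e.toPath) ∨
      b (vertex v) (path e.toPath * pathInv e.toPath) := by
  have ha : a ≤ a ⊔ b := le_sup_left
  have hb : b ≤ a ⊔ b := le_sup_right
  by_contra! hne
  have hno : ∀ ρ : Con (GraphInverseSemigroup V), ρ ≤ a ⊔ b →
      ¬ ρ (vertex v) (path e.toPath * pathInv e.toPath) →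
      ∀ (w' : V) (s : Path v w'), ρ (vertex v) (path s * pathInv s) → s.length = 0 := by
    intro ρ hρ hρe w' s hs
    by_contra hlen
    obtain ⟨x, f, s, rfl⟩ := exists_eq_toPath_comp s hlen
    rcases eq_or_rel_zero (rel_of_rel_comp hs) e with h | h
    · cases h
      exact hρe (rel_of_rel_comp hs)
    · exact hv (rel_zero_of_rel he (hρ h))
  have key : ∀ ρ : Con (GraphInverseSemigroup V), ρ ≤ a ⊔ b →
      ¬ ρ (vertex v) (path e.toPath * pathInv e.toPath) → ∀ x y, ρ x y →
      vertex v * x * vertex v = vertex v → vertex v * y * vertex v = vertex v := by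
    intro ρ hρ hρe x y hxy hx
    have h := ρ.mul (ρ.mul (ρ.refl (vertex v)) hxy) (ρ.refl (vertex v))
    rw [hx] at h
    rcases eq_zero_or_exists_of_local (v := v) (x := vertex v * y * vertex v)
      (by simp [mul_assoc]) with h₀ | ⟨w', s, t, hst⟩
    · exact (hv (hρ (h₀ ▸ h))).elim
    · rw [hst] at h ⊢
      have hs := hno ρ hρ hρe _ _ (rel_left h)
      have ht := hno ρ hρ hρe _ _ (rel_right h)
      obtain rfl := Path.eq_of_length_zero s hs
      rw [Path.eq_nil_of_length_zero s hs, Path.eq_nil_of_length_zero t ht]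
      simp
  have h := sup_invariant (key a ha hne.1) (key b hb hne.2) he (by simp)
  have h' : path e.toPath * pathInv e.toPath = vertex v := by simpa [mul_assoc] using h
  exact hne.1 (h' ▸ a.refl _)

theorem rel_edge (hV : IsUnilaterallyConnected V) (hc : c ≤ a ⊔ b) {v w : V} {e : v ⟶ w}
    (he : c (vertex v) (path e.toPath * pathInv e.toPath)) :
    (a ⊓ c ⊔ b ⊓ c) (vertex v) (path e.toPath * pathInv e.toPath) := by
  have ha : a ⊓ c ≤ a ⊓ c ⊔ b ⊓ c := le_sup_left
  have hb : b ⊓ c ≤ a ⊓ c ⊔ b ⊓ c := le_sup_right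
  by_cases hc₀ : c (vertex v) 0
  · exact rel_of_rel_zero ((vanishes_of_sup_rel_zero (hc hc₀)).rel_zero hc₀) _ _
  · have h : a (vertex v) (path e.toPath * pathInv e.toPath) ∨
        b (vertex v) (path e.toPath * pathInv e.toPath) := by
      by_cases hv : (a ⊔ b) (vertex v) 0
      · exact (vanishes_of_sup_rel_zero hv).rel_edge hV he hc₀
      · exact rel_edge_of_sup_rel_edge hv (hc he)
    exact h.elim (fun h => ha ⟨h, he⟩) fun h => hb ⟨h, he⟩

theorem rel_path (hV : IsUnilaterallyConnected V) (hc : c ≤ a ⊔ b) {v w : V} {p : Path v w}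
    (hp : c (vertex v) (path p * pathInv p)) :
    (a ⊓ c ⊔ b ⊓ c) (vertex v) (path p * pathInv p) := by
  induction p with
  | nil => simpa using (a ⊓ c ⊔ b ⊓ c).refl _
  | cons p e ih =>
    rw [← Path.comp_toPath_eq_cons] at hp ⊢
    exact rel_comp (ih (rel_of_rel_comp hp)) (rel_edge hV hc (rel_comp_right hp))

/-- Either the chain of edges witnessing vanishing follows `u`, and one rotates `u` and inducts, or
it leaves `u`; then the next vertex of `u` is killed, and the rest of `u` carries the zero back to
`v`. -/
theorem Vanishes.rel_zero_of_closed {v : V} (h : Vanishes a b v) (u : Path v v)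
    (hu : u.length ≠ 0) (hc : c (vertex v) (path u)) (hc₀ : ¬ c (vertex v) 0) :
    a (vertex v) 0 ∨ b (vertex v) 0 := by
  induction h with
  | of_rel_zero h => exact h
  | @of_edge v w f h _ ih =>
    obtain ⟨x, e, u, rfl⟩ := exists_eq_toPath_comp u hu
    have key : ∀ ρ : Con (GraphInverseSemigroup V),
        ρ (vertex v) (path f.toPath * pathInv f.toPath) →
          (⟨w, f⟩ : Star v) = ⟨x, e⟩ ∨ ρ (vertex v) 0 := fun ρ hρ =>
      (eq_or_rel_zero hρ e).imp_right (rel_zero_of_path u)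
    have h' : (⟨w, f⟩ : Star v) = ⟨x, e⟩ ∨ a (vertex v) 0 ∨ b (vertex v) 0 :=
      h.elim (fun h => (key a h).imp_right .inl) fun h => (key b h).imp_right .inr
    rcases h' with h' | h'
    · cases h'
      refine (ih (u.comp f.toPath) (by rw [Path.length_comp, Path.length_toPath]; omega) ?_
        fun h => hc₀ (rel_zero_of_path u h)).imp (rel_zero_of_path u) (rel_zero_of_path u)
      rw [path_comp]
      simpa [mul_assoc] using rel_mul_mul hc (pathInv f.toPath) (path f.toPath)
    · exact h'

/-! ### Closed paths and subgroups of `ℤ`. -/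

variable {σ : Con (GraphInverseSemigroup V)}

/-- Distributivity of the subgroup lattice of `ℤ`, elementwise. -/
theorem int_mem_sup_inf {A B C : AddSubgroup ℤ} {n : ℤ} (h : n ∈ A ⊔ B) (hC : n ∈ C) :
    n ∈ (A ⊓ C) ⊔ (B ⊓ C) := by
  obtain ⟨x, hx, y, hy, rfl⟩ := AddSubgroup.mem_sup.1 h
  by_cases h₀ : Int.gcd x y = 0
  · obtain ⟨rfl, rfl⟩ := Int.gcd_eq_zero_iff.1 h₀
    exact zero_mem _
  have hg : (Int.gcd x y : ℤ) ≠ 0 := by exact_mod_cast h₀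
  obtain ⟨x', hx'⟩ := Int.gcd_dvd_left x y
  obtain ⟨y', hy'⟩ := Int.gcd_dvd_right x y
  have hb := Int.gcd_eq_gcd_ab x y
  set g : ℤ := (Int.gcd x y : ℤ)
  set α := Int.gcdA x y
  set β := Int.gcdB x y
  have hb' : x' * α + y' * β = 1 := by
    apply mul_left_cancel₀ hg
    linear_combination (-1 : ℤ) * hb - α * hx' - β * hy'
  -- Split `n = x + y` by Bézout as `α x' n + β y' n`. Since `x = g x'` and `y = g y'`, the first
  -- part is a multiple of both `x` and `n`, the second of both `y` and `n`.
  refine AddSubgroup.mem_sup.2 ⟨α * x' * (x + y), ⟨?_, ?_⟩, β * y' * (x + y), ⟨?_, ?_⟩, ?_⟩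
  · have : α * x' * (x + y) = (α * (x' + y')) • x := by
      rw [smul_eq_mul]
      linear_combination α * x' * (hx' + hy') - α * (x' + y') * hx'
    rw [this]
    exact A.zsmul_mem hx _
  · exact C.zsmul_mem hC (α * x')
  · have : β * y' * (x + y) = (β * (x' + y')) • y := by
      rw [smul_eq_mul]
      linear_combination β * y' * (hx' + hy') - β * (x' + y') * hy'
    rw [this]
    exact B.zsmul_mem hy _
  · exact C.zsmul_mem hC (β * y')
  · linear_combination (x + y) * hb'

/-- The integers `|s| - |t|` for the elements `s t*` related to the vertex `v`. -/
def degrees (hρ : ρ ≤ σ) {v : V} (hv : ¬ σ (vertex v) 0) : AddSubgroup ℤ where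
  carrier := {n | ∃ (w : V) (s t : Path v w), ρ (vertex v) (path s * pathInv t) ∧
    n = s.length - t.length}
  zero_mem' := ⟨v, .nil, .nil, by simpa using ρ.refl _, by simp⟩
  neg_mem' := by
    rintro n ⟨w, s, t, h, rfl⟩
    exact ⟨w, t, s, rel_inv h, by ring⟩
  add_mem' := by
    rintro m n ⟨w, s, t, h, rfl⟩ ⟨w', s', t', h', rfl⟩
    have hm := ρ.mul h h'
    rcases prefix_or_prefix hv (hρ (rel_right h)) (hρ (rel_left h')) with ⟨r, rfl⟩ | ⟨r, rfl⟩
    · refine ⟨w', s.comp r, t', by simpa [mul_assoc] using hm, ?_⟩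
      push_cast [Path.length_comp]
      ring
    · refine ⟨w, s, t'.comp r, by simpa [mul_assoc] using hm, ?_⟩
      push_cast [Path.length_comp]
      ring

/-- Unequal lengths give a nontrivial closed path `r` with `w ~ r`; following its powers yields
related paths long enough to have `p` as a prefix. -/
theorem rel_path_of_length_ne (hρ : ρ ≤ σ) {v w x : V} (hv : ¬ σ (vertex v) 0) {s t : Path v w}
    (h : ρ (vertex v) (path s * pathInv t)) (hst : s.length ≠ t.length) {p : Path v x}
    (hp : σ (vertex v) (path p * pathInv p)) : ρ (vertex v) (path p * pathInv p) := by
  wlog hlt : t.length < s.length generalizing s t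
  · exact this (rel_inv h) hst.symm (by omega)
  obtain ⟨r, rfl⟩ := prefix_of_length_le hv (hρ (rel_right h)) (hρ (rel_left h)) hlt.le
  rw [Path.length_comp] at hlt
  have hr : ρ (vertex w) (path r) := by
    simpa using rel_comp_right (s := t) (t := r) (t' := .nil) h
  obtain ⟨R, hR, hR'⟩ := exists_long_closed_path (by omega) hr p.length
  have h₁ := rel_comp (rel_right h) (rel_left (p := R) (q := .nil) (by simpa using hR'))
  obtain ⟨y, hy⟩ := prefix_of_length_le hv hp (hρ h₁) (by rw [Path.length_comp]; omega)
  rw [hy] at h₁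
  exact rel_of_rel_comp h₁

theorem sub_mem_degrees (hρ : ρ ≤ σ) {v w w' : V} (hv : ¬ σ (vertex v) 0) {u : Path v v}
    (hu : u.length ≠ 0) (huv : σ (vertex v) (path u)) {s t : Path v w} {s' t' : Path v w'}
    (hst : σ (vertex v) (path s * pathInv t)) (hst' : σ (vertex v) (path s' * pathInv t'))
    (h : ρ (path s * pathInv t) (path s' * pathInv t')) :
    ((s'.length : ℤ) - t'.length) - (s.length - t.length) ∈ degrees hρ hv := by
  obtain ⟨S, hS, hS'⟩ := exists_long_closed_path hu huv (max s.length s'.length)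
  replace hS' := rel_left (p := S) (q := .nil) (by simpa using hS')
  obtain ⟨S₁, hS₁⟩ := prefix_of_length_le hv (rel_left hst) hS' (by omega)
  obtain ⟨r, hr⟩ := prefix_of_length_le hv (rel_left hst') hS' (by omega)
  have hT : σ (vertex v) (path (t.comp S₁) * pathInv (t.comp S₁)) :=
    rel_comp (rel_right hst) (rel_comp_right (hS₁ ▸ hS'))
  have hT' : σ (vertex v) (path (t'.comp r) * pathInv (t'.comp r)) :=
    rel_comp (rel_right hst') (rel_comp_right (hr ▸ hS'))
  -- With `S = s S₁ = s' r`, multiplying by `S*` on the left and `t S₁` on the right turns `s t*`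
  -- into `v` and `s' t'*` into `(t' r)* (t S₁)`. The latter is a closed path or its inverse, of the
  -- required degree.
  have h₁ : ρ (vertex v) (pathInv (t'.comp r) * path (t.comp S₁)) := by
    have h₂ := rel_mul_mul h (pathInv S) (path (t.comp S₁))
    nth_rw 1 [hS₁] at h₂
    rw [hr] at h₂
    simpa [mul_assoc] using h₂
  have hl₁ := congrArg Path.length hS₁
  have hl₂ := congrArg Path.length hr
  rw [Path.length_comp] at hl₁ hl₂
  rcases prefix_or_prefix hv hT hT' with ⟨y, hy⟩ | ⟨y, hy⟩
  · have hl₃ := congrArg Path.length hy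
    simp only [Path.length_comp] at hl₃
    rw [hy, pathInv_comp, mul_assoc, pathInv_mul_path, pathInv_mul_vertex] at h₁
    exact ⟨v, .nil, y, by simpa using h₁, by rw [Path.length_nil]; omega⟩
  · have hl₃ := congrArg Path.length hy
    simp only [Path.length_comp] at hl₃
    rw [hy, path_comp, pathInv_mul_path_mul, vertex_mul_path] at h₁
    exact ⟨v, y, .nil, by simpa using h₁, by rw [Path.length_nil]; omega⟩

theorem degrees_sup {v : V} (hv : ¬ (a ⊔ b) (vertex v) 0) {u : Path v v}
    (hu : u.length ≠ 0) (huv : (a ⊔ b) (vertex v) (path u)) :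
    (u.length : ℤ) ∈
      degrees (le_sup_left : a ≤ a ⊔ b) hv ⊔ degrees (le_sup_right : b ≤ a ⊔ b) hv := by
  set D := degrees (le_sup_left : a ≤ a ⊔ b) hv ⊔ degrees (le_sup_right : b ≤ a ⊔ b) hv
  let T : GraphInverseSemigroup V → Prop := fun z => ∃ (w : V) (s t : Path v w),
    vertex v * z * vertex v = path s * pathInv t ∧ (a ⊔ b) (vertex v) (path s * pathInv t) ∧
      (s.length : ℤ) - t.length ∈ D
  have key : ∀ (ρ : Con (GraphInverseSemigroup V)) (hρ : ρ ≤ a ⊔ b), degrees hρ hv ≤ D →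
      ∀ x y, ρ x y → T x → T y := by
    rintro ρ hρ hle x y hxy ⟨w, s, t, hx, hst, hmem⟩
    have h := ρ.mul (ρ.mul (ρ.refl (vertex v)) hxy) (ρ.refl (vertex v))
    rw [hx] at h
    have h' := (a ⊔ b).trans hst (hρ h)
    rcases eq_zero_or_exists_of_local (v := v) (x := vertex v * y * vertex v)
      (by simp [mul_assoc]) with h₀ | ⟨w', s', t', hy⟩
    · exact (hv (h₀ ▸ h')).elim
    · rw [hy] at h h'
      refine ⟨w', s', t', hy, h', ?_⟩
      have := D.add_mem hmem (hle (sub_mem_degrees hρ hv hu huv hst h' h))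
      simpa using this
  have hT : T (path u) := by
    refine sup_invariant (key a le_sup_left le_sup_left) (key b le_sup_right le_sup_right) huv
      ⟨v, .nil, .nil, by simp, by simpa using (a ⊔ b).refl _, by simp⟩
  obtain ⟨w, s, t, hz, hst, hmem⟩ := hT
  have h : path s * pathInv t = path u * pathInv (.nil : Path v v) := by
    rw [← hz]
    simp
  -- Uniqueness of normal forms is not needed: the reflexive relation between `s t*` and `u` already
  -- puts the difference of their degrees in `D`.
  have h₁ := sub_mem_degrees le_sup_left hv hu huv hst
    (s' := u) (t' := .nil) (by simpa using huv) (h ▸ a.refl _)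
  have h₂ : degrees (le_sup_left : a ≤ a ⊔ b) hv ≤ D := le_sup_left
  simpa using D.add_mem hmem (h₂ h₁)

/-- For `n ≠ 0`, take the longer of the two witnesses. It is the shorter one extended by a common
path `r` on both sides, and `rel_path_of_length_ne` makes the other congruence relate `r r*` to its
source. -/
theorem mem_degrees_inf {a c : Con (GraphInverseSemigroup V)} (ha : a ≤ σ) (hc : c ≤ σ) {v : V}
    (hv : ¬ σ (vertex v) 0) {n : ℤ} (hna : n ∈ degrees ha hv) (hnc : n ∈ degrees hc hv) :
    n ∈ degrees (inf_le_left.trans ha : a ⊓ c ≤ σ) hv := by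
  obtain ⟨w, s, t, h, rfl⟩ := hna
  obtain ⟨w', s', t', h', hn⟩ := hnc
  by_cases hst : s.length = t.length
  · rw [hst, sub_self]
    exact zero_mem _
  have key : ∀ {a c : Con (GraphInverseSemigroup V)} (_ : a ≤ σ) (_ : c ≤ σ) {w w' : V}
      {s t : Path v w} {s' t' : Path v w'}, a (vertex v) (path s * pathInv t) →
      c (vertex v) (path s' * pathInv t') → (s.length : ℤ) - t.length = s'.length - t'.length →
      s.length ≠ t.length → s.length ≤ s'.length → a (vertex v) (path s' * pathInv t') := by
    intro a c ha hc w w' s t s' t' h h' hn hst hle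
    obtain ⟨r, rfl⟩ := prefix_of_length_le hv (ha (rel_left h)) (hc (rel_left h')) hle
    rw [Path.length_comp] at hn
    obtain ⟨r', rfl⟩ := prefix_of_length_le hv (ha (rel_right h)) (hc (rel_right h'))
      (by push_cast at hn; omega)
    rw [Path.length_comp] at hn
    have hw : ¬ σ (vertex w) 0 := fun hw => hv (rel_zero_of_rel (ha h) hw)
    obtain rfl : r' = r := eq_of_length_eq hw (rel_comp_right (hc (rel_right h')))
      (rel_comp_right (hc (rel_left h'))) (by push_cast at hn; omega)
    exact rel_comp h (rel_comp_right (rel_path_of_length_ne ha hv h hst (hc (rel_left h'))))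
  rcases le_total s.length s'.length with hle | hle
  · exact ⟨w', s', t', ⟨key ha hc h h' hn hst hle, h'⟩, hn⟩
  · exact ⟨w, s, t, ⟨h, key hc ha h' h hn.symm (by omega) hle⟩, rfl⟩

theorem rel_closed (hc : c ≤ a ⊔ b) {v : V} {u : Path v v} (h : c (vertex v) (path u)) :
    (a ⊓ c ⊔ b ⊓ c) (vertex v) (path u) := by
  have ha : a ⊓ c ≤ a ⊓ c ⊔ b ⊓ c := le_sup_left
  have hb : b ⊓ c ≤ a ⊓ c ⊔ b ⊓ c := le_sup_right
  by_cases hu : u.length = 0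
  · rw [Path.eq_nil_of_length_zero u hu]
    exact (a ⊓ c ⊔ b ⊓ c).refl _
  by_cases hv : (a ⊔ b) (vertex v) 0
  · have hvan := vanishes_of_sup_rel_zero hv
    have zero : ∀ {ρ : Con (GraphInverseSemigroup V)}, ρ (vertex v) 0 →
        ρ (vertex v) (path u) := fun h => by
      simpa using rel_of_rel_zero h u (vertex v)
    by_cases hc₀ : c (vertex v) 0
    · exact zero (hvan.rel_zero hc₀)
    · exact (hvan.rel_zero_of_closed u hu h hc₀).elim (fun h' => ha ⟨zero h', h⟩)
        fun h' => hb ⟨zero h', h⟩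
  · have hd : a ⊓ c ⊔ b ⊓ c ≤ a ⊔ b := sup_le_sup inf_le_left inf_le_left
    have h₁ : (u.length : ℤ) ∈ degrees hc hv := ⟨v, u, .nil, by simpa using h, by simp⟩
    have h₂ : (u.length : ℤ) ∈ degrees hd hv := by
      obtain ⟨x, ⟨hx, hx'⟩, y, ⟨hy, hy'⟩, hxy⟩ :=
        AddSubgroup.mem_sup.1 (int_mem_sup_inf (degrees_sup hv hu (hc h)) h₁)
      obtain ⟨w, s, t, hst, hn⟩ := mem_degrees_inf _ _ hv hx hx'
      obtain ⟨w', s', t', hst', hn'⟩ := mem_degrees_inf _ _ hv hy hy'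
      rw [← hxy]
      exact add_mem ⟨w, s, t, ha hst, hn⟩ ⟨w', s', t', hb hst', hn'⟩
    obtain ⟨w, s, t, hst, hn⟩ := h₂
    -- From `v ~ s t*` of degree `|u|`, comparing lengths forces `s = u t`; then `v ~ u t t* ~ u`.
    obtain ⟨r, rfl⟩ := prefix_of_length_le hv
      (rel_left (p := u) (q := .nil) (by simpa using hc h)) (hd (rel_left hst)) (by omega)
    rw [Path.length_comp] at hn
    obtain rfl : r = t := eq_of_length_eq hv (rel_comp_right (hd (rel_left hst)))
      (hd (rel_right hst)) (by push_cast at hn; omega)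
    refine (a ⊓ c ⊔ b ⊓ c).trans hst ((a ⊓ c ⊔ b ⊓ c).symm ?_)
    simpa [mul_assoc] using (a ⊓ c ⊔ b ⊓ c).mul ((a ⊓ c ⊔ b ⊓ c).refl (path u)) (rel_right hst)

/-! ### Assembling the three kinds of relation. -/

theorem le_of_le_sup (hV : IsUnilaterallyConnected V) (hc : c ≤ a ⊔ b) :
    c ≤ a ⊓ c ⊔ b ⊓ c := by
  intro x y hxy
  refine rel_of_local (σ := c) (fun v z hz h => ?_) hxy
  set d := a ⊓ c ⊔ b ⊓ c
  rcases eq_zero_or_exists_of_local hz with rfl | ⟨w, s, t, rfl⟩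
  · exact (vanishes_of_sup_rel_zero (hc h)).rel_zero h
  · have hs : d (vertex v) (path s * pathInv s) := rel_path hV hc (rel_left h)
    have ht : d (vertex v) (path t * pathInv t) := rel_path hV hc (rel_right h)
    rcases prefix_or_prefix_or_pathInv_mul_path_eq_zero s t with ⟨r, rfl⟩ | ⟨r, rfl⟩ | h₀
    · have hr : d (vertex w) (path r * pathInv (.nil : Path w w)) := by
        simpa using rel_closed hc (u := r)
          (by simpa using rel_inv (rel_comp_right (s := s) (t := .nil) (t' := r) h))
      exact rel_comp (t := .nil) hs (rel_inv hr)
    · have hr : d (vertex w) (path r * pathInv (.nil : Path w w)) := by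
        simpa using rel_closed hc (u := r)
          (by simpa using rel_comp_right (s := t) (t := r) (t' := .nil) h)
      exact rel_comp (t' := .nil) ht hr
    · refine rel_of_rel_zero ?_ _ _
      have h₁ := d.mul hs ht
      rw [mul_assoc, ← mul_assoc (pathInv s), h₀] at h₁
      simpa using h₁

theorem isDistributiveLattice (hV : IsUnilaterallyConnected V) :
    IsDistributiveLattice (Con (GraphInverseSemigroup V)) := by
  intro a b c
  refine le_antisymm ?_ (le_inf (sup_le_sup inf_le_left inf_le_left)
    (sup_le inf_le_right inf_le_right))
  -- The element below the join is taken to be `(a ⊔ b) ⊓ c`.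
  refine (le_of_le_sup hV inf_le_left).trans (sup_le_sup ?_ ?_) <;>
  exact inf_le_inf_left _ inf_le_right

theorem not_isForked (hV : IsUnilaterallyConnected V) (v : V) : ¬ IsForked v := by
  rintro ⟨e, f, hef, he, hf⟩
  exact (hV e.1 f.1).elim (hf e hef) (he f hef.symm)

end GraphInverse

theorem mainTheorem5 {V : Type*} [Quiver V] :
    (Quiver.IsUnilaterallyConnected V →
      (∀ v : V, ¬ Quiver.IsForked v) ∧
        IsDistributiveLattice (Con (GraphInverseSemigroup V))) ∧
    (Quiver.IsStronglyConnected V →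
      (∀ v : V, ¬ Quiver.IsForked v) ∧
        IsDistributiveLattice (Con (GraphInverseSemigroup V))) :=
  ⟨fun h => ⟨GraphInverse.not_isForked h, GraphInverse.isDistributiveLattice h⟩,
    fun h => ⟨GraphInverse.not_isForked fun v w => .inl (h v w),
      GraphInverse.isDistributiveLattice fun v w => .inl (h v w)⟩⟩
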